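/- Let $N\in\mathbb N$, let $\langle\cdot,\cdot\rangle$ and $|\cdot|$ be the Euclidean inner product and norm on $\mathbb R^N$, and let $I=(a,b)$ with $-\infty<a<b<\infty$. Let $G:\mathbb R^N\to[0,\infty)$ be a convex, even function of class $C^1$ with $G(0)=0$ such that - $G(x)/|x|\to\infty$ as $|x|\to\infty$; - ($\Delta_2$) there are $K_1\ge 2$ and $M_1>0$ with $G(2x)\le K_1G(x)$ for all $|x|\ge M_1$; - ($\nabla_2$) there are $K_2\ge 1$ and $M_2>0$ with $G(x)\le \frac1{2K_2}G(K_2x)$ for all $|x|\ge M_2$. Let $L^G=L^G(I,\mathbb R^N)$ be the linear space of (a.e. equivalence classes of) measurable $u:I\to\mathbb R^N$ with $\int_I G(u)\,dt<\infty$, normed by the Luxemburg norm $\|u\|_{L^G}=\inf\{\alpha>0:\int_I G(u/\alpha)\,dt\le 1\}$. Let $W^1L^G=W^1L^G(I,\mathbb R^N)$ be the space of those $u\in L^G$ that have a weak derivative $\dot u\in L^G$, normed by $\|u\|_{W^1L^G}=\|u\|_{L^G}+\|\dot u\|_{L^G}$. Consider the functional $\mathcal I(u)=\int_I F(t,u,\dot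 u)\,dt$ in the special case $F(t,x,v)=G(v)$, that is, $$\mathcal I(u)=\int_I G(\dot u)\,dt .$$ Then $\mathcal I$ is finite on $W^1L^G$ and $\mathcal I\in C^1(W^1L^G,\mathbb R)$, i.e. $\mathcal I$ is Fréchet differentiable everywhere and its derivative $\mathcal I':W^1L^G\to(W^1L^G)^*$ is continuous with respect to the operator norm. Moreover, for all $u,\varphi\in W^1L^G$, the function $\langle\nabla G(\dot u),\dot\varphi\rangle$ is integrable on $I$ and $$\mathcal I'(u)\varphi=\int_I\langle\nabla G(\dot u),\dot\varphi\rangle\,dt .$$ -/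

import Mathlib

open MeasureTheory Set Filter Topology Bornology
open scoped ContDiff

/-- G-functions on `ℝ^N`: nonnegative, convex, even, supercoercive functions vanishing at the origin
that satisfy the `Δ₂` and `∇₂` conditions for large arguments. -/
structure GFunction (N : ℕ) where
  toFun : EuclideanSpace ℝ (Fin N) → ℝ
  nonneg' : ∀ x, 0 ≤ toFun x
  map_zero' : toFun 0 = 0
  convex' : ConvexOn ℝ univ toFun
  even' : ∀ x, toFun (-x) = toFun x
  supercoercive' : Tendsto (fun x => toFun x / ‖x‖) (cobounded (EuclideanSpace ℝ (Fin N))) atTop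
  delta_two' : ∃ K : ℝ, 2 ≤ K ∧ ∃ M : ℝ, 0 < M ∧
    ∀ x, M ≤ ‖x‖ → toFun ((2 : ℝ) • x) ≤ K * toFun x
  nabla_two' : ∃ K : ℝ, 1 ≤ K ∧ ∃ M : ℝ, 0 < M ∧
    ∀ x, M ≤ ‖x‖ → toFun x ≤ 1 / (2 * K) * toFun (K • x)

instance GFunction.instCoeFun (N : ℕ) :
    CoeFun (GFunction N) (fun _ => EuclideanSpace ℝ (Fin N) → ℝ) := ⟨GFunction.toFun⟩

namespace GFunction

variable {N : ℕ} (G : GFunction N)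

theorem continuous : Continuous G := by
  have h := G.convex'.continuousOn isOpen_univ
  exact continuousOn_univ.1 h

theorem smul_le {s : ℝ} (h0 : 0 ≤ s) (h1 : s ≤ 1) (x : EuclideanSpace ℝ (Fin N)) :
    G (s • x) ≤ s * G x := by
  have h := G.convex'.2 (mem_univ x) (mem_univ 0) h0 (sub_nonneg.2 h1) (by ring)
  simpa [G.map_zero'] using h

theorem abs_smul (c : ℝ) (x : EuclideanSpace ℝ (Fin N)) : G (|c| • x) = G (c • x) := by
  rcases abs_choice c with h | h
  · rw [h]
  · rw [h, neg_smul, G.even']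

theorem smul_mono {c d : ℝ} (h : |c| ≤ d) (x : EuclideanSpace ℝ (Fin N)) :
    G (c • x) ≤ G (d • x) := by
  rcases (abs_nonneg c).trans h |>.eq_or_lt with h0 | h0
  · have : c = 0 := abs_eq_zero.1 (le_antisymm (h0 ▸ h) (abs_nonneg c))
    rw [this, ← h0]
  · rw [← G.abs_smul c]
    have h1 : |c| • x = (|c| / d) • (d • x) := by
      rw [smul_smul, div_mul_cancel₀ _ h0.ne']
    rw [h1]
    have h2 : |c| / d ≤ 1 := (div_le_one h0).2 h
    have h3 := G.smul_le (div_nonneg (abs_nonneg c) h0.le) h2 (d • x)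
    have h4 := G.nonneg' (d • x)
    nlinarith

theorem exists_two_smul_le : ∃ C K : ℝ, ∀ x, G ((2 : ℝ) • x) ≤ C + K * G x := by
  obtain ⟨K, hK, M, -, h⟩ := G.delta_two'
  have hc : Continuous fun x => G ((2 : ℝ) • x) := G.continuous.comp (continuous_const_smul _)
  obtain ⟨C, hC⟩ := ((isCompact_closedBall (0 : EuclideanSpace ℝ (Fin N)) M).image hc).bddAbove
  refine ⟨max C 0, K, fun x => ?_⟩
  have hx := G.nonneg' x
  rcases le_total M ‖x‖ with hM | hM
  · have := h x hM
    have := le_max_right C 0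
    linarith
  · have h1 : G ((2 : ℝ) • x) ≤ C := hC ⟨x, by simpa using hM, rfl⟩
    have h2 := le_max_left C 0
    have : 0 ≤ K * G x := mul_nonneg (by linarith) hx
    linarith

theorem exists_norm_le : ∃ C : ℝ, ∀ x, ‖x‖ ≤ C + G x := by
  have h := G.supercoercive'.eventually (eventually_ge_atTop 1)
  rw [← comap_norm_atTop, eventually_comap] at h
  obtain ⟨R, hR⟩ := eventually_atTop.1 h
  refine ⟨max R 1, fun x => ?_⟩
  have hx := G.nonneg' x
  rcases le_total (max R 1) ‖x‖ with h1 | h1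
  · have h2 := hR ‖x‖ ((le_max_left _ _).trans h1) x rfl
    have h3 : 0 < ‖x‖ := zero_lt_one.trans_le ((le_max_right R 1).trans h1)
    rw [le_div_iff₀ h3] at h2
    have := le_max_right R 1
    linarith
  · linarith

theorem eq_zero_of_forall_nat {x : EuclideanSpace ℝ (Fin N)}
    (h : ∀ n : ℕ, G ((n : ℝ) • x) = 0) : x = 0 := by
  obtain ⟨C, hC⟩ := G.exists_norm_le
  by_contra hx
  have hx' : 0 < ‖x‖ := norm_pos_iff.2 hx
  obtain ⟨n, hn⟩ := exists_nat_gt (C / ‖x‖)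
  have h1 := hC ((n : ℝ) • x)
  rw [h n, norm_smul, Real.norm_natCast, add_zero] at h1
  rw [div_lt_iff₀ hx'] at hn
  linarith

variable {Ω : Type*} [MeasurableSpace Ω] {μ : Measure Ω}

theorem aesm (u : Ω →ₘ[μ] EuclideanSpace ℝ (Fin N)) (c : ℝ) :
    AEStronglyMeasurable (fun t => G (c • u t)) μ :=
  G.continuous.comp_aestronglyMeasurable (u.aestronglyMeasurable.const_smul c)

variable [IsFiniteMeasure μ]

theorem integrable_two {u : Ω →ₘ[μ] EuclideanSpace ℝ (Fin N)}
    (hu : Integrable (fun t => G (u t)) μ) :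
    Integrable (fun t => G ((2 : ℝ) • u t)) μ := by
  obtain ⟨C, K, h⟩ := G.exists_two_smul_le
  refine Integrable.mono' ((integrable_const C).add (hu.const_mul K)) (G.aesm u 2) ?_
  refine Eventually.of_forall fun t => ?_
  rw [Real.norm_of_nonneg (G.nonneg' _)]
  exact h (u t)

theorem integrable_add {u v : Ω →ₘ[μ] EuclideanSpace ℝ (Fin N)}
    (hu : Integrable (fun t => G (u t)) μ) (hv : Integrable (fun t => G (v t)) μ) :
    Integrable (fun t => G ((u + v : Ω →ₘ[μ] EuclideanSpace ℝ (Fin N)) t)) μ := by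
  refine Integrable.mono' (((G.integrable_two hu).const_mul (1 / 2)).add
    ((G.integrable_two hv).const_mul (1 / 2)))
    (G.continuous.comp_aestronglyMeasurable (AEEqFun.aestronglyMeasurable _)) ?_
  filter_upwards [AEEqFun.coeFn_add u v] with t ht
  rw [Real.norm_of_nonneg (G.nonneg' _), ht]
  have h := G.convex'.2 (mem_univ ((2 : ℝ) • u t)) (mem_univ ((2 : ℝ) • v t))
    (by norm_num : (0 : ℝ) ≤ 1 / 2) (by norm_num : (0 : ℝ) ≤ 1 / 2) (by norm_num)
  simpa [smul_smul] using h

theorem integrable_nat_smul {u : Ω →ₘ[μ] EuclideanSpace ℝ (Fin N)}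
    (hu : Integrable (fun t => G (u t)) μ) (n : ℕ) :
    Integrable (fun t => G ((n : ℝ) • u t)) μ := by
  have key : Integrable (fun t => G ((n • u : Ω →ₘ[μ] EuclideanSpace ℝ (Fin N)) t)) μ := by
    induction n with
    | zero =>
      refine (integrable_zero Ω ℝ μ).congr ?_
      filter_upwards [AEEqFun.coeFn_zero (α := Ω) (μ := μ) (β := EuclideanSpace ℝ (Fin N))]
        with t ht
      simp [ht, G.map_zero']
    | succ n ih =>
      rw [succ_nsmul]
      exact G.integrable_add ih hu
  refine key.congr ?_
  rw [← Nat.cast_smul_eq_nsmul ℝ n u]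
  filter_upwards [AEEqFun.coeFn_smul (n : ℝ) u] with t ht
  rw [ht, Pi.smul_apply]

theorem integrable_smul {u : Ω →ₘ[μ] EuclideanSpace ℝ (Fin N)}
    (hu : Integrable (fun t => G (u t)) μ) (c : ℝ) :
    Integrable (fun t => G (c • u t)) μ := by
  obtain ⟨n, hn⟩ := exists_nat_ge |c|
  refine Integrable.mono' (G.integrable_nat_smul hu n) (G.aesm u c) ?_
  refine Eventually.of_forall fun t => ?_
  rw [Real.norm_of_nonneg (G.nonneg' _)]
  exact G.smul_mono hn (u t)

end GFunction

/-! ### The anisotropic Orlicz space -/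

section Orlicz

variable {N : ℕ} (G : GFunction N) {Ω : Type*} [MeasurableSpace Ω]
  (μ : Measure Ω) [IsFiniteMeasure μ]

/-- The set of classes (modulo a.e. equality) of measurable `u : Ω → ℝ^N` with `∫ G(u) dμ < ∞`,
as a linear subspace of the space of all classes of measurable functions. -/
def orliczSubmodule : Submodule ℝ (Ω →ₘ[μ] EuclideanSpace ℝ (Fin N)) where
  carrier := {u | Integrable (fun t => G (u t)) μ}
  zero_mem' := by
    refine (integrable_zero Ω ℝ μ).congr ?_
    filter_upwards [AEEqFun.coeFn_zero (α := Ω) (μ := μ) (β := EuclideanSpace ℝ (Fin N))]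
      with t ht
    simp [ht, G.map_zero']
  add_mem' hu hv := G.integrable_add hu hv
  smul_mem' c u hu := by
    refine (G.integrable_smul hu c).congr ?_
    filter_upwards [AEEqFun.coeFn_smul c u] with t ht
    rw [ht, Pi.smul_apply]

/-- The anisotropic Orlicz space `L^G(μ; ℝ^N)`. -/
def OrliczSpace : Type _ := orliczSubmodule G μ

noncomputable instance OrliczSpace.instAddCommGroup : AddCommGroup (OrliczSpace G μ) :=
  inferInstanceAs (AddCommGroup (orliczSubmodule G μ))

noncomputable instance OrliczSpace.instModule : Module ℝ (OrliczSpace G μ) :=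
  inferInstanceAs (Module ℝ (orliczSubmodule G μ))

variable {G μ} in
/-- The a.e.-class of functions underlying an element of `L^G`. -/
def OrliczSpace.toAEEqFun (u : OrliczSpace G μ) : Ω →ₘ[μ] EuclideanSpace ℝ (Fin N) := u.1

noncomputable instance OrliczSpace.instCoeFun :
    CoeFun (OrliczSpace G μ) (fun _ => Ω → EuclideanSpace ℝ (Fin N)) :=
  ⟨fun u => u.toAEEqFun⟩

/-- The Luxemburg norm `inf {α > 0 : ∫ G(u/α) dμ ≤ 1}`. -/
noncomputable instance OrliczSpace.instNorm : Norm (OrliczSpace G μ) :=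
  ⟨fun u => sInf {α : ℝ | 0 < α ∧ ∫ t, G (α⁻¹ • u t) ∂μ ≤ 1}⟩

namespace OrliczSpace

variable {G μ}

theorem ext_ae {u v : OrliczSpace G μ} (h : (u : Ω → EuclideanSpace ℝ (Fin N)) =ᵐ[μ] v) : u = v :=
  Subtype.ext (AEEqFun.ext h)

theorem coeFn_add (u v : OrliczSpace G μ) : ∀ᵐ t ∂μ, (u + v) t = u t + v t :=
  AEEqFun.coeFn_add u.1 v.1

theorem coeFn_smul (c : ℝ) (u : OrliczSpace G μ) : ∀ᵐ t ∂μ, (c • u) t = c • u t :=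
  AEEqFun.coeFn_smul c u.1

theorem coeFn_zero : ∀ᵐ t ∂μ, (0 : OrliczSpace G μ) t = 0 :=
  AEEqFun.coeFn_zero

theorem integrable_smul (u : OrliczSpace G μ) (c : ℝ) : Integrable (fun t => G (c • u t)) μ :=
  G.integrable_smul u.2 c

theorem integrable (u : OrliczSpace G μ) : Integrable u μ := by
  obtain ⟨C, hC⟩ := G.exists_norm_le
  refine Integrable.mono' ((integrable_const C).add (u.integrable_smul 1))
    (AEEqFun.aestronglyMeasurable _) (Eventually.of_forall fun t => ?_)
  simpa using hC (u t)

theorem norm_def (u : OrliczSpace G μ) :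
    ‖u‖ = sInf {α : ℝ | 0 < α ∧ ∫ t, G (α⁻¹ • u t) ∂μ ≤ 1} := rfl

theorem norm_nonneg' (u : OrliczSpace G μ) : 0 ≤ ‖u‖ :=
  Real.sInf_nonneg fun _ h => h.1.le

theorem norm_le_of_integral {u : OrliczSpace G μ} {α : ℝ} (h0 : 0 < α)
    (h : ∫ t, G (α⁻¹ • u t) ∂μ ≤ 1) : ‖u‖ ≤ α :=
  csInf_le ⟨0, fun _ h => h.1.le⟩ ⟨h0, h⟩

theorem integral_mono_scale (u : OrliczSpace G μ) {α β : ℝ} (h0 : 0 < α) (h : α ≤ β) :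
    ∫ t, G (β⁻¹ • u t) ∂μ ≤ α / β * ∫ t, G (α⁻¹ • u t) ∂μ := by
  rw [← integral_const_mul]
  refine integral_mono (u.integrable_smul _) ((u.integrable_smul _).const_mul _) fun t => ?_
  have hβ := h0.trans_le h
  have h1 : β⁻¹ • u t = (α / β) • (α⁻¹ • u t) := by
    rw [smul_smul]; congr 1; field_simp
  change G (β⁻¹ • u t) ≤ _
  rw [h1]
  exact G.smul_le (by positivity) ((div_le_one hβ).2 h) _

theorem scales_nonempty (u : OrliczSpace G μ) :
    {α : ℝ | 0 < α ∧ ∫ t, G (α⁻¹ • u t) ∂μ ≤ 1}.Nonempty := by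
  set R := ∫ t, G ((1 : ℝ)⁻¹ • u t) ∂μ with hR
  have hβ : (1 : ℝ) ≤ max 1 R := le_max_left _ _
  have hβ0 : (0 : ℝ) < max 1 R := zero_lt_one.trans_le hβ
  refine ⟨max 1 R, hβ0, (u.integral_mono_scale one_pos hβ).trans ?_⟩
  rw [← hR, one_div, inv_mul_le_iff₀ hβ0, mul_one]
  exact le_max_right _ _

theorem integral_le_one_of_norm_lt {u : OrliczSpace G μ} {α : ℝ} (h : ‖u‖ < α) :
    0 < α ∧ ∫ t, G (α⁻¹ • u t) ∂μ ≤ 1 := by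
  obtain ⟨β, ⟨hβ0, hβ⟩, hlt⟩ := exists_lt_of_csInf_lt u.scales_nonempty h
  have hα := hβ0.trans hlt
  refine ⟨hα, (u.integral_mono_scale hβ0 hlt.le).trans ?_⟩
  have h1 : β / α ≤ 1 := (div_le_one hα).2 hlt.le
  have h2 : 0 ≤ β / α := by positivity
  have h3 : 0 ≤ ∫ t, G (β⁻¹ • u t) ∂μ := integral_nonneg fun t => G.nonneg' _
  nlinarith

theorem norm_add_le' (u v : OrliczSpace G μ) : ‖u + v‖ ≤ ‖u‖ + ‖v‖ := by
  refine le_of_forall_pos_le_add fun ε hε => ?_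
  obtain ⟨hα, h1⟩ := integral_le_one_of_norm_lt (u := u) (α := ‖u‖ + ε / 2) (by linarith)
  obtain ⟨hβ, h2⟩ := integral_le_one_of_norm_lt (u := v) (α := ‖v‖ + ε / 2) (by linarith)
  set α := ‖u‖ + ε / 2
  set β := ‖v‖ + ε / 2
  have hsum : ‖u‖ + ‖v‖ + ε = α + β := by simp only [α, β]; ring
  rw [hsum]
  have hab : 0 < α + β := by positivity
  refine norm_le_of_integral hab ?_
  have hle : ∫ t, G ((α + β)⁻¹ • (u + v) t) ∂μ
      ≤ ∫ t, (α / (α + β) * G (α⁻¹ • u t) + β / (α + β) * G (β⁻¹ • v t)) ∂μ := by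
    refine integral_mono_ae ((u + v).integrable_smul _)
      (((u.integrable_smul _).const_mul _).add ((v.integrable_smul _).const_mul _)) ?_
    filter_upwards [coeFn_add u v] with t ht
    have h := G.convex'.2 (mem_univ (α⁻¹ • u t)) (mem_univ (β⁻¹ • v t))
      (by positivity : 0 ≤ α / (α + β)) (by positivity : 0 ≤ β / (α + β))
      (by field_simp)
    have e : (α + β)⁻¹ • (u + v) t
        = (α / (α + β)) • (α⁻¹ • u t) + (β / (α + β)) • (β⁻¹ • v t) := by
      rw [ht, smul_add, smul_smul, smul_smul]
      congr 2 <;> field_simp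
    rw [e]
    simpa using h
  rw [integral_add ((u.integrable_smul _).const_mul _) ((v.integrable_smul _).const_mul _),
    integral_const_mul, integral_const_mul] at hle
  refine hle.trans ?_
  calc α / (α + β) * ∫ t, G (α⁻¹ • u t) ∂μ + β / (α + β) * ∫ t, G (β⁻¹ • v t) ∂μ
      ≤ α / (α + β) * 1 + β / (α + β) * 1 := by gcongr
    _ = 1 := by field_simp

theorem norm_zero' : ‖(0 : OrliczSpace G μ)‖ = 0 := by
  refine le_antisymm (le_of_forall_pos_le_add fun ε hε => ?_) (norm_nonneg' _)
  rw [zero_add]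
  refine norm_le_of_integral hε ?_
  have : ∫ t, G (ε⁻¹ • (0 : OrliczSpace G μ) t) ∂μ = ∫ _, (0 : ℝ) ∂μ := by
    refine integral_congr_ae ?_
    filter_upwards [coeFn_zero (G := G) (μ := μ)] with t ht
    rw [ht, smul_zero, G.map_zero']
  rw [this]
  simp

theorem norm_smul_le' (c : ℝ) (u : OrliczSpace G μ) : ‖c • u‖ ≤ |c| * ‖u‖ := by
  rcases eq_or_ne c 0 with rfl | hc
  · rw [zero_smul, norm_zero']; simp
  have hc' : 0 < |c| := abs_pos.2 hc
  rw [mul_comm, ← div_le_iff₀ hc']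
  refine le_of_forall_pos_le_add fun ε hε => ?_
  obtain ⟨hα, h1⟩ := integral_le_one_of_norm_lt (u := u) (α := ‖u‖ + ε) (by linarith)
  set α := ‖u‖ + ε
  rw [div_le_iff₀ hc']
  refine norm_le_of_integral (by positivity) (le_of_eq_of_le ?_ h1)
  refine integral_congr_ae ?_
  filter_upwards [coeFn_smul c u] with t ht
  rw [ht, smul_smul, ← G.abs_smul, ← G.abs_smul α⁻¹]
  congr 2
  rw [abs_mul, abs_inv, abs_mul, abs_abs, abs_inv]
  field_simp

theorem eq_zero_of_norm_eq_zero {u : OrliczSpace G μ} (h : ‖u‖ = 0) : u = 0 := by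
  have key : ∀ n : ℕ, ∀ᵐ t ∂μ, G ((n : ℝ) • u t) = 0 := by
    intro n
    have hn : ‖(n : ℝ) • u‖ ≤ 0 := by simpa [h] using norm_smul_le' (n : ℝ) u
    have h0 : ∫ t, G ((n : ℝ) • u t) ∂μ = 0 := by
      refine le_antisymm (le_of_forall_pos_le_add fun ε hε => ?_)
        (integral_nonneg fun t => G.nonneg' _)
      obtain ⟨hα, h1⟩ := integral_le_one_of_norm_lt (u := (n : ℝ) • u) (α := min ε 1)
        (hn.trans_lt (by positivity))
      have h2 := ((n : ℝ) • u).integral_mono_scale hα (min_le_right ε 1)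
      have h3 : ∫ t, G ((1 : ℝ)⁻¹ • ((n : ℝ) • u) t) ∂μ = ∫ t, G ((n : ℝ) • u t) ∂μ := by
        refine integral_congr_ae ?_
        filter_upwards [coeFn_smul (n : ℝ) u] with t ht
        rw [ht, inv_one, one_smul]
      rw [h3, div_one] at h2
      have h4 := min_le_left ε 1
      have h5 : min ε 1 * ∫ t, G ((min ε 1)⁻¹ • ((n : ℝ) • u) t) ∂μ ≤ min ε 1 * 1 :=
        mul_le_mul_of_nonneg_left h1 hα.le
      linarith
    exact (integral_eq_zero_iff_of_nonneg (fun t => G.nonneg' _) (u.integrable_smul _)).1 h0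
  refine ext_ae ?_
  filter_upwards [ae_all_iff.2 key, coeFn_zero (G := G) (μ := μ)] with t ht h0
  rw [h0, G.eq_zero_of_forall_nat ht]

theorem core : NormedSpace.Core ℝ (OrliczSpace G μ) where
  norm_nonneg := norm_nonneg'
  norm_smul c u := by
    refine le_antisymm (norm_smul_le' c u) ?_
    rcases eq_or_ne c 0 with rfl | hc
    · simpa using norm_nonneg' _
    have h := norm_smul_le' c⁻¹ (c • u)
    rw [inv_smul_smul₀ hc, abs_inv] at h
    rwa [Real.norm_eq_abs, ← le_inv_mul_iff₀ (abs_pos.2 hc)]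
  norm_triangle := norm_add_le'
  norm_eq_zero_iff u := ⟨eq_zero_of_norm_eq_zero, fun h => h ▸ norm_zero'⟩

end OrliczSpace

noncomputable instance OrliczSpace.instNormedAddCommGroup : NormedAddCommGroup (OrliczSpace G μ) :=
  NormedAddCommGroup.ofCore OrliczSpace.core

noncomputable instance OrliczSpace.instNormedSpace : NormedSpace ℝ (OrliczSpace G μ) :=
  NormedSpace.ofCore OrliczSpace.core

end Orlicz

/-! ### The anisotropic Orlicz-Sobolev space on the interval `(a, b)` -/

section OrliczSobolev

variable {N : ℕ} (G : GFunction N) (a b : ℝ)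

/-- `v` is a weak derivative of `u` on `(a, b)`: `∫ φ' u = - ∫ φ v` for all
`φ ∈ C_c^∞((a, b); ℝ)`. -/
def IsWeakDeriv (u v : ℝ → EuclideanSpace ℝ (Fin N)) : Prop :=
  ∀ φ : ℝ → ℝ, ContDiff ℝ ∞ φ → HasCompactSupport φ → tsupport φ ⊆ Ioo a b →
    ∫ t in Ioo a b, deriv φ t • u t = - ∫ t in Ioo a b, φ t • v t

/-- The Orlicz space `L^G((a, b); ℝ^N)` for Lebesgue measure. -/
abbrev LG : Type := OrliczSpace G (volume.restrict (Ioo a b))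

variable {G a b}

theorem LG.integrable_bdd_smul (u : LG G a b) {φ : ℝ → ℝ} (h : Continuous φ)
    (hs : HasCompactSupport φ) : Integrable (fun t => φ t • u t) (volume.restrict (Ioo a b)) := by
  obtain ⟨C, hC⟩ := hs.exists_bound_of_continuous h
  exact u.integrable.bdd_smul C h.aestronglyMeasurable (Eventually.of_forall hC)

theorem LG.integral_add_smul (u v : LG G a b) (c : ℝ) {φ : ℝ → ℝ} (h : Continuous φ)
    (hs : HasCompactSupport φ) :
    ∫ t in Ioo a b, φ t • (u + c • v : LG G a b) t
      = (∫ t in Ioo a b, φ t • u t) + c • ∫ t in Ioo a b, φ t • v t := by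
  have hv : Integrable (fun t => c • (φ t • v t)) (volume.restrict (Ioo a b)) :=
    (v.integrable_bdd_smul h hs).smul c
  rw [← integral_smul, ← integral_add (u.integrable_bdd_smul h hs) hv]
  refine integral_congr_ae ?_
  filter_upwards [OrliczSpace.coeFn_add u (c • v), OrliczSpace.coeFn_smul c v] with t h1 h2
  rw [h1, h2, smul_add, smul_comm]

theorem IsWeakDeriv.add_smul {u u' v v' : LG G a b} (hu : IsWeakDeriv a b u u')
    (hv : IsWeakDeriv a b v v') (c : ℝ) :
    IsWeakDeriv a b (u + c • v : LG G a b) (u' + c • v' : LG G a b) := by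
  intro φ h hs hU
  rw [LG.integral_add_smul u v c (h.continuous_deriv (by simp)) hs.deriv,
    LG.integral_add_smul u' v' c h.continuous hs, hu φ h hs hU, hv φ h hs hU]
  rw [smul_neg, neg_add]

theorem isWeakDeriv_zero : IsWeakDeriv a b (0 : LG G a b) (0 : LG G a b) := by
  have key : ∀ φ : ℝ → ℝ, ∫ t in Ioo a b, φ t • (0 : LG G a b) t = 0 := by
    intro φ
    refine integral_eq_zero_of_ae ?_
    filter_upwards [OrliczSpace.coeFn_zero (G := G) (μ := volume.restrict (Ioo a b))] with t ht
    rw [ht, smul_zero, Pi.zero_apply]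
  intro φ _ _ _
  rw [key, key, neg_zero]

theorem IsWeakDeriv.unique {u v w : LG G a b} (hv : IsWeakDeriv a b u v)
    (hw : IsWeakDeriv a b u w) : v = w := by
  rw [← sub_eq_zero]
  refine OrliczSpace.ext_ae ?_
  have h0 := isOpen_Ioo.ae_eq_zero_of_integral_contDiff_smul_eq_zero (μ := volume)
    (f := (v - w : LG G a b)) (U := Ioo a b)
    (IntegrableOn.locallyIntegrableOn (v - w : LG G a b).integrable) (fun φ h hs hU => by
      rw [← setIntegral_eq_integral_of_forall_compl_eq_zero (s := Ioo a b)]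
      · have h1 := LG.integral_add_smul v w (-1) h.continuous hs
        rw [neg_one_smul, ← sub_eq_add_neg] at h1
        rw [h1, neg_one_smul, ← hw φ h hs hU, hv φ h hs hU, add_neg_cancel]
      · intro t ht
        rw [image_eq_zero_of_notMem_tsupport (fun h' => ht (hU h')), zero_smul])
  have h1 : ∀ᵐ t ∂(volume.restrict (Ioo a b)), (v - w : LG G a b) t = 0 :=
    (ae_restrict_iff' measurableSet_Ioo).2 h0
  filter_upwards [h1, OrliczSpace.coeFn_zero (G := G) (μ := volume.restrict (Ioo a b))] with t h2 h3
  rw [h2, h3]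

variable (G a b)

/-- Those `u ∈ L^G` that have a weak derivative in `L^G`. -/
def orliczSobolevSubmodule : Submodule ℝ (LG G a b) where
  carrier := {u | ∃ v : LG G a b, IsWeakDeriv a b u v}
  zero_mem' := ⟨0, isWeakDeriv_zero⟩
  add_mem' := by
    rintro u v ⟨u', hu⟩ ⟨v', hv⟩
    exact ⟨u' + (1 : ℝ) • v', by simpa using hu.add_smul hv 1⟩
  smul_mem' := by
    rintro c u ⟨u', hu⟩
    exact ⟨0 + c • u', by simpa using isWeakDeriv_zero.add_smul hu c⟩

/-- The anisotropic Orlicz-Sobolev space `W^1 L^G((a, b); ℝ^N)`. -/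
def W1LG : Type := orliczSobolevSubmodule G a b

noncomputable instance W1LG.instAddCommGroup : AddCommGroup (W1LG G a b) :=
  inferInstanceAs (AddCommGroup (orliczSobolevSubmodule G a b))

noncomputable instance W1LG.instModule : Module ℝ (W1LG G a b) :=
  inferInstanceAs (Module ℝ (orliczSobolevSubmodule G a b))

namespace W1LG

variable {G a b}

/-- The element of `L^G` underlying `u ∈ W^1 L^G`. -/
def toLG (u : W1LG G a b) : LG G a b := u.1

/-- The weak derivative `u̇ ∈ L^G` of `u ∈ W^1 L^G`. -/
noncomputable def dot (u : W1LG G a b) : LG G a b := Classical.choose u.2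

theorem isWeakDeriv_dot (u : W1LG G a b) : IsWeakDeriv a b u.toLG u.dot :=
  Classical.choose_spec u.2

theorem toLG_add (u v : W1LG G a b) : (u + v).toLG = u.toLG + v.toLG := rfl

theorem toLG_smul (c : ℝ) (u : W1LG G a b) : (c • u).toLG = c • u.toLG := rfl

theorem dot_add (u v : W1LG G a b) : (u + v).dot = u.dot + v.dot := by
  refine (u + v).isWeakDeriv_dot.unique ?_
  simpa [toLG_add] using u.isWeakDeriv_dot.add_smul v.isWeakDeriv_dot 1

theorem dot_smul (c : ℝ) (u : W1LG G a b) : (c • u).dot = c • u.dot := by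
  refine (c • u).isWeakDeriv_dot.unique ?_
  simpa [toLG_smul] using isWeakDeriv_zero.add_smul u.isWeakDeriv_dot c

/-- The norm `‖u‖_{L^G} + ‖u̇‖_{L^G}`. -/
noncomputable instance instNorm : Norm (W1LG G a b) := ⟨fun u => ‖u.toLG‖ + ‖u.dot‖⟩

theorem norm_def (u : W1LG G a b) : ‖u‖ = ‖u.toLG‖ + ‖u.dot‖ := rfl

theorem core : NormedSpace.Core ℝ (W1LG G a b) where
  norm_nonneg u := add_nonneg (norm_nonneg _) (norm_nonneg _)
  norm_smul c u := by
    rw [norm_def, norm_def, dot_smul, toLG_smul, norm_smul, norm_smul, mul_add]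
  norm_triangle u v := by
    rw [norm_def, norm_def, norm_def, dot_add, toLG_add]
    have h1 := norm_add_le u.toLG v.toLG
    have h2 := norm_add_le u.dot v.dot
    linarith
  norm_eq_zero_iff u := by
    constructor
    · intro h
      rw [norm_def] at h
      have h1 : ‖u.toLG‖ = 0 :=
        le_antisymm (by have := norm_nonneg u.dot; linarith) (norm_nonneg _)
      exact Subtype.ext (norm_eq_zero.1 h1)
    · rintro rfl
      have h1 : (0 : W1LG G a b).dot = 0 := by
        simpa using dot_smul (0 : ℝ) (0 : W1LG G a b)
      have h2 : (0 : W1LG G a b).toLG = 0 := rfl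
      rw [norm_def, h1, h2, norm_zero, add_zero]

end W1LG

noncomputable instance W1LG.instNormedAddCommGroup : NormedAddCommGroup (W1LG G a b) :=
  NormedAddCommGroup.ofCore W1LG.core

noncomputable instance W1LG.instNormedSpace : NormedSpace ℝ (W1LG G a b) :=
  NormedSpace.ofCore W1LG.core

variable {G a b}

/-- The functional `u ↦ ∫_I F(t, u, u̇) dt` on `W^1 L^G`, with `I = (a, b)`. -/
noncomputable def lagrangianFunctional
    (F : ℝ → EuclideanSpace ℝ (Fin N) → EuclideanSpace ℝ (Fin N) → ℝ) (u : W1LG G a b) : ℝ :=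
  ∫ t in Ioo a b, F t (u.toLG t) (u.dot t)

end OrliczSobolev

/-! ### Pointwise inequalities for a differentiable `G`. -/

namespace GFunction

variable {N : ℕ} (G : GFunction N)

/-! Since `u ↦ u̇` is a bounded linear map from `W1LG` to `LG`, the chain rule reduces everything to
the modular `Φ(v) = ∫ G(v)` being of class `C¹` on `L^G`, with derivative `Φ'(v)φ = ∫ G'(v)φ`.

Convexity makes differentiability a consequence of continuity of `v ↦ Φ'(v)`: the subgradient
inequality at `v` and at `v + φ` gives `Φ'(v)φ ≤ Φ(v + φ) - Φ(v) ≤ Φ'(v + φ)φ`, so the remainder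
lies between `0` and `‖Φ'(v + φ) - Φ'(v)‖ ‖φ‖`.

Norm continuity of `Φ'` (`continuous_modularDeriv`) needs estimates uniform over `∫ G(φ) ≤ 1`. They
rest on the Young-type inequality `G'(x)y ≤ ε G(y) + C (1 + G(x))` of `exists_fderiv_apply_le`: `Δ₂`
controls the doubling of arguments, and `∇₂` makes `ε` arbitrarily small. The term in `G(φ)` is then
uniformly small, and the remaining term no longer involves `φ` and vanishes by dominated convergence
along an a.e. convergent subsequence (`tendsto_integral_mul_comp`). -/

theorem fderiv_apply_le_sub (hd : Differentiable ℝ G) (x y : EuclideanSpace ℝ (Fin N)) :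
    fderiv ℝ G x y ≤ G (x + y) - G x := by
  -- On the line through `x` in direction `y`, the derivative at `0` is at most the slope over `[0,
  -- 1]`.
  have hconv : ConvexOn ℝ univ fun s : ℝ => G (x + s • y) := by
    have h := G.convex'.comp_affineMap (AffineMap.lineMap x (x + y) : ℝ →ᵃ[ℝ] _)
    have e : G ∘ (AffineMap.lineMap x (x + y) : ℝ →ᵃ[ℝ] _) = fun s : ℝ => G (x + s • y) := by
      ext s
      simp [AffineMap.lineMap_apply, add_comm]
    rwa [e, preimage_univ] at h
  have hder : HasDerivAt (fun s : ℝ => G (x + s • y)) (fderiv ℝ G x y) 0 := by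
    have h1 : HasDerivAt (fun s : ℝ => x + s • y) y 0 := by
      simpa using ((hasDerivAt_id (0 : ℝ)).smul_const y).const_add x
    have h2 : HasFDerivAt G (fderiv ℝ G x) (x + (0 : ℝ) • y) := by
      simpa using (hd x).hasFDerivAt
    exact h2.comp_hasDerivAt (0 : ℝ) h1
  simpa [slope_def_field] using
    hconv.le_slope_of_hasDerivAt (mem_univ 0) (mem_univ 1) one_pos hder

theorem midpoint_le (x y : EuclideanSpace ℝ (Fin N)) :
    G (x + y) ≤ 1 / 2 * G ((2 : ℝ) • x) + 1 / 2 * G ((2 : ℝ) • y) := by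
  have h := G.convex'.2 (mem_univ ((2 : ℝ) • x)) (mem_univ ((2 : ℝ) • y))
    (by norm_num : (0 : ℝ) ≤ 1 / 2) (by norm_num : (0 : ℝ) ≤ 1 / 2) (by norm_num)
  simpa [smul_smul] using h

/-- The `∇₂` condition, valid for all arguments up to an additive constant. -/
theorem exists_nabla_two : ∃ K : ℝ, 1 ≤ K ∧ ∃ C : ℝ, 0 ≤ C ∧
    ∀ x, G x ≤ C + 1 / (2 * K) * G (K • x) := by
  obtain ⟨K, hK, M, -, h⟩ := G.nabla_two'
  obtain ⟨C, hC⟩ :=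
    ((isCompact_closedBall (0 : EuclideanSpace ℝ (Fin N)) M).image G.continuous).bddAbove
  refine ⟨K, hK, max C 0, le_max_right _ _, fun x => ?_⟩
  rcases le_total M ‖x‖ with hM | hM
  · have := h x hM
    have := le_max_right C 0
    linarith
  · have h1 : G x ≤ C := hC ⟨x, by simpa using hM, rfl⟩
    have h2 := le_max_left C 0
    have : 0 ≤ 1 / (2 * K) * G (K • x) := mul_nonneg (by positivity) (G.nonneg' _)
    linarith

/-- Iterating `∇₂` gives `L = K ^ m`: each rescaling by `K` costs the factor `K` in front, which
cancels against `1 / (2 * K)` and leaves a gain of `1 / 2`. Convexity alone would only give `L * G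
(L⁻¹ • y) ≤ G y`, with no gain. -/
theorem exists_nabla_two_pow (m : ℕ) : ∃ L : ℝ, 0 < L ∧ ∃ C : ℝ, 0 ≤ C ∧
    ∀ y, L * G (L⁻¹ • y) ≤ C + (1 / 2) ^ m * G y := by
  obtain ⟨K, hK, C₀, hC₀, hK'⟩ := G.exists_nabla_two
  have hK0 : 0 < K := one_pos.trans_le hK
  induction m with
  | zero => exact ⟨1, one_pos, 0, le_rfl, fun y => by simp⟩
  | succ m ih =>
    obtain ⟨L, hL, C, hC, h⟩ := ih
    refine ⟨K * L, by positivity, K * L * C₀ + C / 2, by positivity, fun y => ?_⟩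
    have h1 := hK' ((K * L)⁻¹ • y)
    have h2 : K • ((K * L)⁻¹ • y) = L⁻¹ • y := by
      rw [smul_smul]; congr 1; field_simp
    rw [h2] at h1
    calc K * L * G ((K * L)⁻¹ • y)
        ≤ K * L * (C₀ + 1 / (2 * K) * G (L⁻¹ • y)) := by gcongr
      _ = K * L * C₀ + 1 / 2 * (L * G (L⁻¹ • y)) := by field_simp
      _ ≤ K * L * C₀ + 1 / 2 * (C + (1 / 2) ^ m * G y) := by gcongr; exact h y
      _ = _ := by ring

/-- A Young-type inequality with an arbitrarily small constant in front of `G y`. -/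
theorem exists_fderiv_apply_le (hd : Differentiable ℝ G) {ε : ℝ} (hε : 0 < ε) :
    ∃ C : ℝ, 0 ≤ C ∧ ∀ x y, fderiv ℝ G x y ≤ ε * G y + C * (1 + G x) := by
  obtain ⟨C₂, K₂, h2⟩ := G.exists_two_smul_le
  have h2' : ∀ x, G ((2 : ℝ) • x) ≤ (|C₂| + |K₂|) * (1 + G x) := fun x => by
    have h0 := G.nonneg' x
    have := h2 x
    have := le_abs_self C₂
    have := mul_le_mul_of_nonneg_right (le_abs_self K₂) h0
    have := mul_nonneg (abs_nonneg C₂) h0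
    have := abs_nonneg K₂
    linarith
  set A := |C₂| + |K₂| with hA
  have hA0 : 0 ≤ A := by positivity
  obtain ⟨m, hm⟩ : ∃ m : ℕ, A * (1 / 2 : ℝ) ^ m < ε := by
    obtain ⟨m, hm⟩ := exists_pow_lt_of_lt_one (show 0 < ε / (A + 1) by positivity)
      (by norm_num : (1 / 2 : ℝ) < 1)
    refine ⟨m, ?_⟩
    rw [lt_div_iff₀ (by positivity)] at hm
    have : (0 : ℝ) < (1 / 2) ^ m := by positivity
    linarith
  obtain ⟨L, hL, C, hC, h⟩ := G.exists_nabla_two_pow m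
  refine ⟨L * A + A * C, by positivity, fun x y => ?_⟩
  -- Linearity in `y` lets the subgradient inequality be used at the small increment `L⁻¹ • y`, so
  -- that only `L * G (L⁻¹ • y)` enters.
  have e : fderiv ℝ G x y = L * fderiv ℝ G x (L⁻¹ • y) := by
    rw [map_smul, smul_eq_mul, mul_inv_cancel_left₀ hL.ne']
  have hx := G.nonneg' x
  have hy := G.nonneg' y
  have hz := G.nonneg' (L⁻¹ • y)
  calc fderiv ℝ G x y ≤ L * (1 / 2 * (A * (1 + G x)) + 1 / 2 * (A * (1 + G (L⁻¹ • y)))) := by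
        rw [e]
        gcongr
        have h3 := G.fderiv_apply_le_sub hd x (L⁻¹ • y)
        have h4 := G.midpoint_le x (L⁻¹ • y)
        have h5 := h2' x
        have h6 := h2' (L⁻¹ • y)
        linarith
    _ = 1 / 2 * (L * A * (1 + G x)) + 1 / 2 * (L * A) + 1 / 2 * A * (L * G (L⁻¹ • y)) := by ring
    _ ≤ 1 / 2 * (L * A * (1 + G x)) + 1 / 2 * (L * A)
        + 1 / 2 * A * (C + (1 / 2) ^ m * G y) := by gcongr; exact h y
    _ ≤ ε * G y + (L * A + A * C) * (1 + G x) := by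
        have h3 : A * (1 / 2 : ℝ) ^ m * G y ≤ ε * G y := by gcongr
        have h4 : 0 ≤ L * A * G x := by positivity
        have h5 : 0 ≤ A * C * G x := by positivity
        have h6 : 0 ≤ A * C := by positivity
        have h7 : 0 ≤ A * (1 / 2 : ℝ) ^ m * G y := by positivity
        linarith

/-- A dichotomy on the size of the difference of derivatives. If it is large, the minimum is `1` and
the Young-type inequality is used at `(x, y)` and `(z, -y)`, each with `ε / 2`. If it is small, the
operator norm bound and the linear growth `‖y‖ ≤ B (1 + G y)` suffice, and `D = B / ε` is the
matching threshold. -/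
theorem exists_fderiv_sub_apply_le (hd : Differentiable ℝ G) {ε : ℝ} (hε : 0 < ε) :
    ∃ C : ℝ, 0 ≤ C ∧ ∃ D : ℝ, 0 ≤ D ∧ ∀ x z y, (fderiv ℝ G x - fderiv ℝ G z) y ≤
      ε * (1 + G y) + C * (min 1 (D * ‖fderiv ℝ G x - fderiv ℝ G z‖) * (1 + G x + G z)) := by
  obtain ⟨C₁, hC₁, h1⟩ := G.exists_fderiv_apply_le hd (half_pos hε)
  obtain ⟨C₀, h0⟩ := G.exists_norm_le
  have hB : 0 < max C₀ 1 := one_pos.trans_le (le_max_right _ _)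
  refine ⟨2 * C₁, by positivity, max C₀ 1 / ε, by positivity, fun x z y => ?_⟩
  have hx := G.nonneg' x
  have hz := G.nonneg' z
  have hy := G.nonneg' y
  rcases le_total 1 (max C₀ 1 / ε * ‖fderiv ℝ G x - fderiv ℝ G z‖) with h | h
  · rw [min_eq_left h, sub_apply]
    have h2 := h1 x y
    have h3 := h1 z (-y)
    rw [map_neg, G.even'] at h3
    have : 0 ≤ C₁ * G x := by positivity
    have : 0 ≤ C₁ * G z := by positivity
    linarith
  · have h2 := (le_abs_self _).trans ((fderiv ℝ G x - fderiv ℝ G z).le_opNorm y)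
    have h3 : ‖y‖ ≤ max C₀ 1 * (1 + G y) := by
      have := h0 y
      have := le_max_left C₀ 1
      have := mul_le_mul_of_nonneg_right (le_max_right C₀ 1) hy
      linarith
    have h4 : ‖fderiv ℝ G x - fderiv ℝ G z‖ * max C₀ 1 ≤ ε := by
      rw [div_mul_eq_mul_div, div_le_one hε] at h
      linarith
    have h5 : 0 ≤ 2 * C₁ * (min 1 (max C₀ 1 / ε * ‖fderiv ℝ G x - fderiv ℝ G z‖) *
        (1 + G x + G z)) := by positivity
    calc _ ≤ _ := h2
      _ ≤ ‖fderiv ℝ G x - fderiv ℝ G z‖ * (max C₀ 1 * (1 + G y)) := by gcongr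
      _ = ‖fderiv ℝ G x - fderiv ℝ G z‖ * max C₀ 1 * (1 + G y) := by ring
      _ ≤ ε * (1 + G y) := by gcongr
      _ ≤ _ := by linarith

end GFunction

/-! ### Modular, Luxemburg norm and a.e. convergence. -/

namespace OrliczSpace

variable {N : ℕ} {G : GFunction N} {Ω : Type*} [MeasurableSpace Ω]
  {μ : Measure Ω} [IsFiniteMeasure μ]

theorem integrable_comp (u : OrliczSpace G μ) : Integrable (fun t => G (u t)) μ := u.2

theorem aestronglyMeasurable (u : OrliczSpace G μ) : AEStronglyMeasurable u μ :=
  AEEqFun.aestronglyMeasurable _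

theorem coeFn_sub (u v : OrliczSpace G μ) : ∀ᵐ t ∂μ, (u - v) t = u t - v t :=
  AEEqFun.coeFn_sub u.1 v.1

/-- For `‖u‖ < α ≤ 1`, convexity and `G 0 = 0` give `∫ G(u) ≤ α ∫ G(u/α) ≤ α`; let `α` decrease to
`‖u‖`. -/
theorem integral_comp_le_norm {u : OrliczSpace G μ} (h : ‖u‖ < 1) : ∫ t, G (u t) ∂μ ≤ ‖u‖ := by
  refine le_of_forall_gt_imp_ge_of_dense fun α hα => ?_
  rcases le_total α 1 with h1 | h1
  · obtain ⟨h0, h2⟩ := integral_le_one_of_norm_lt hα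
    have h3 := u.integral_mono_scale h0 h1
    simp only [inv_one, one_smul, div_one] at h3
    exact h3.trans (mul_le_of_le_one_right h0.le h2)
  · simpa using (integral_le_one_of_norm_lt h).2.trans (by simpa using h1)

/-- A positively homogeneous function that is bounded by `B` on the modular unit ball is bounded
by `B` times the Luxemburg norm. -/
theorem le_mul_norm_of_modular_le {p : OrliczSpace G μ → ℝ}
    (hp : ∀ c : ℝ, 0 < c → ∀ u, p (c • u) = c * p u) {B : ℝ} (hB : 0 ≤ B)
    (h : ∀ u : OrliczSpace G μ, ∫ t, G (u t) ∂μ ≤ 1 → p u ≤ B) (u : OrliczSpace G μ) :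
    p u ≤ B * ‖u‖ := by
  refine le_of_forall_pos_le_add fun ε hε => ?_
  -- The denominator is `B + 1` rather than `B` so that `B = 0` is allowed.
  obtain ⟨hα, h1⟩ := integral_le_one_of_norm_lt (u := u) (α := ‖u‖ + ε / (B + 1))
    (lt_add_of_pos_right _ (by positivity))
  set α := ‖u‖ + ε / (B + 1) with hα'
  have h2 := h (α⁻¹ • u) (by
    refine le_of_eq_of_le (integral_congr_ae ?_) h1
    filter_upwards [coeFn_smul α⁻¹ u] with t ht
    rw [ht])
  rw [hp _ (by positivity), inv_mul_le_iff₀ hα] at h2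
  have h3 : B * (ε / (B + 1)) ≤ ε := by
    rw [mul_div_assoc', div_le_iff₀ (by positivity)]
    nlinarith
  calc p u ≤ α * B := h2
    _ = B * ‖u‖ + B * (ε / (B + 1)) := by rw [hα']; ring
    _ ≤ B * ‖u‖ + ε := by gcongr

/-- The embedding of `L^G` into `L¹`: superlinear growth bounds `‖x‖` by `C + G x`, hence the `L¹`
norm on the modular unit ball, and homogeneity does the rest. -/
theorem exists_integral_norm_le : ∃ C : ℝ, ∀ u : OrliczSpace G μ, ∫ t, ‖u t‖ ∂μ ≤ C * ‖u‖ := by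
  obtain ⟨C, hC⟩ := G.exists_norm_le
  refine ⟨max (∫ _, C ∂μ + 1) 0, le_mul_norm_of_modular_le ?_ (le_max_right _ _) ?_⟩
  · intro c hc u
    rw [← integral_const_mul]
    refine integral_congr_ae ?_
    filter_upwards [coeFn_smul c u] with t ht
    rw [ht, norm_smul, Real.norm_of_nonneg hc.le]
  · intro u hu
    refine le_trans ?_ (le_max_left _ _)
    calc ∫ t, ‖u t‖ ∂μ ≤ ∫ t, (C + G (u t)) ∂μ :=
          integral_mono u.integrable.norm ((integrable_const C).add u.integrable_comp)
            fun t => hC (u t)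
      _ = ∫ _, C ∂μ + ∫ t, G (u t) ∂μ := integral_add (integrable_const C) u.integrable_comp
      _ ≤ _ := by gcongr

/-- Convergence in `L^G` implies convergence in `L¹`, hence in measure, hence a.e. along a
subsequence. -/
theorem exists_subseq_tendsto_ae {v : ℕ → OrliczSpace G μ} {w : OrliczSpace G μ}
    (h : Tendsto v atTop (𝓝 w)) :
    ∃ ns : ℕ → ℕ, StrictMono ns ∧ ∀ᵐ t ∂μ, Tendsto (fun k => v (ns k) t) atTop (𝓝 (w t)) := by
  obtain ⟨C, hC⟩ := exists_integral_norm_le (G := G) (μ := μ)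
  have h0 : Tendsto (fun n => C * ‖v n - w‖) atTop (𝓝 0) := by
    simpa using (tendsto_iff_norm_sub_tendsto_zero.1 h).const_mul C
  have h1 : Tendsto (fun n => ∫ t, ‖v n t - w t‖ ∂μ) atTop (𝓝 0) := by
    refine squeeze_zero (fun n => integral_nonneg fun t => norm_nonneg _) (fun n => ?_) h0
    refine le_of_eq_of_le (integral_congr_ae ?_) (hC (v n - w))
    filter_upwards [coeFn_sub (v n) w] with t ht
    rw [ht]
  refine (tendstoInMeasure_of_tendsto_eLpNorm one_ne_zero
    (fun n => (v n).aestronglyMeasurable) w.aestronglyMeasurable ?_).exists_seq_tendsto_ae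
  have h2 := ENNReal.tendsto_ofReal h1
  rw [ENNReal.ofReal_zero] at h2
  refine h2.congr fun n => ?_
  rw [eLpNorm_one_eq_lintegral_enorm]
  exact ofReal_integral_norm_eq_lintegral_enorm ((v n).integrable.sub w.integrable)

/-! ### The candidate derivative as a bounded functional on `L^G`. -/

theorem fderiv_apply_aestronglyMeasurable (hG : ContDiff ℝ 1 G) (v φ : OrliczSpace G μ) :
    AEStronglyMeasurable (fun t => fderiv ℝ G (v t) (φ t)) μ := by
  have h : Continuous fun p : EuclideanSpace ℝ (Fin N) × EuclideanSpace ℝ (Fin N) =>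
      fderiv ℝ G p.1 p.2 :=
    ((hG.continuous_fderiv one_ne_zero).comp continuous_fst).clm_apply continuous_snd
  exact h.comp_aestronglyMeasurable (v.aestronglyMeasurable.prodMk φ.aestronglyMeasurable)

theorem integrable_fderiv_apply (hG : ContDiff ℝ 1 G) (v φ : OrliczSpace G μ) :
    Integrable (fun t => fderiv ℝ G (v t) (φ t)) μ := by
  obtain ⟨C, -, h⟩ := G.exists_fderiv_apply_le (hG.differentiable one_ne_zero) one_pos
  refine Integrable.mono' (φ.integrable_comp.add
    (((integrable_const (1 : ℝ)).add v.integrable_comp).const_mul C))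
    (fderiv_apply_aestronglyMeasurable hG v φ) (Eventually.of_forall fun t => ?_)
  have h1 := h (v t) (φ t)
  -- Evenness of `G` turns the one-sided bound into a bound on the absolute value.
  have h2 := h (v t) (-φ t)
  rw [map_neg, G.even'] at h2
  rw [Real.norm_eq_abs]
  simp only [Pi.add_apply]
  exact abs_le.2 ⟨by linarith, by linarith⟩

/-- The linear functional `φ ↦ ∫ G'(v) φ dμ` on `L^G`. -/
noncomputable def modularDerivLinear (hG : ContDiff ℝ 1 G) (v : OrliczSpace G μ) :
    OrliczSpace G μ →ₗ[ℝ] ℝ where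
  toFun φ := ∫ t, fderiv ℝ G (v t) (φ t) ∂μ
  map_add' φ ψ := by
    rw [← integral_add (integrable_fderiv_apply hG v φ) (integrable_fderiv_apply hG v ψ)]
    refine integral_congr_ae ?_
    filter_upwards [coeFn_add φ ψ] with t ht
    rw [ht, map_add]
  map_smul' c φ := by
    rw [RingHom.id_apply, smul_eq_mul, ← integral_const_mul]
    refine integral_congr_ae ?_
    filter_upwards [coeFn_smul c φ] with t ht
    rw [ht, map_smul, smul_eq_mul]

theorem norm_apply_le_of_modular_le (L : OrliczSpace G μ →ₗ[ℝ] ℝ) {B : ℝ} (hB : 0 ≤ B)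
    (h : ∀ u : OrliczSpace G μ, ∫ t, G (u t) ∂μ ≤ 1 → L u ≤ B) (u : OrliczSpace G μ) :
    ‖L u‖ ≤ B * ‖u‖ := by
  have key := le_mul_norm_of_modular_le (p := L) (fun c _ u => by simp) hB h
  have h1 := key u
  have h2 := key (-u)
  rw [map_neg, norm_neg] at h2
  exact abs_le.2 ⟨by linarith, h1⟩

theorem exists_modularDerivLinear_bound (hG : ContDiff ℝ 1 G) (v : OrliczSpace G μ) :
    ∃ B : ℝ, ∀ φ, ‖modularDerivLinear hG v φ‖ ≤ B * ‖φ‖ := by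
  obtain ⟨C, hC, h⟩ := G.exists_fderiv_apply_le (hG.differentiable one_ne_zero) one_pos
  have hi : Integrable (fun t => C * (1 + G (v t))) μ :=
    ((integrable_const (1 : ℝ)).add v.integrable_comp).const_mul C
  have h0 : 0 ≤ ∫ t, C * (1 + G (v t)) ∂μ := integral_nonneg fun t => by
    have := G.nonneg' (v t)
    positivity
  refine ⟨1 + ∫ t, C * (1 + G (v t)) ∂μ,
    norm_apply_le_of_modular_le _ (by positivity) fun φ hφ => ?_⟩
  calc ∫ t, fderiv ℝ G (v t) (φ t) ∂μ ≤ ∫ t, (G (φ t) + C * (1 + G (v t))) ∂μ :=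
        integral_mono (integrable_fderiv_apply hG v φ) (φ.integrable_comp.add hi)
          fun t => by simpa using h (v t) (φ t)
    _ = ∫ t, G (φ t) ∂μ + ∫ t, C * (1 + G (v t)) ∂μ := integral_add φ.integrable_comp hi
    _ ≤ _ := by gcongr

/-- The continuous linear functional `φ ↦ ∫ G'(v) φ dμ` on `L^G`. -/
noncomputable def modularDeriv (hG : ContDiff ℝ 1 G) (v : OrliczSpace G μ) :
    OrliczSpace G μ →L[ℝ] ℝ :=
  (modularDerivLinear hG v).mkContinuousOfExistsBound (exists_modularDerivLinear_bound hG v)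

theorem modularDeriv_apply (hG : ContDiff ℝ 1 G) (v φ : OrliczSpace G μ) :
    modularDeriv hG v φ = ∫ t, fderiv ℝ G (v t) (φ t) ∂μ := rfl

/-! ### Norm continuity of the derivative. -/

/-- Multiplying by a factor in `[0, 1]` that tends to `0` a.e. along `v n → w` makes the integral
of `1 + G (v n) + G w` vanish in the limit. -/
theorem tendsto_integral_mul_comp {v : ℕ → OrliczSpace G μ} {w : OrliczSpace G μ}
    (h : Tendsto v atTop (𝓝 w)) {ρ : ℕ → Ω → ℝ} (hm : ∀ n, AEStronglyMeasurable (ρ n) μ)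
    (h0 : ∀ n t, 0 ≤ ρ n t) (h1 : ∀ n t, ρ n t ≤ 1)
    (hρ : ∀ᵐ t ∂μ, Tendsto (fun n => ρ n t) atTop (𝓝 0)) :
    Tendsto (fun n => ∫ t, ρ n t * (1 + G (v n t) + G (w t)) ∂μ) atTop (𝓝 0) := by
  -- The functions `G (v n)` need not have a common integrable majorant. Midpoint convexity for `v n
  -- = w + (v n - w)` splits off `1 / 2 * G (2 • w)`, which goes into the fixed majorant `g`; the
  -- other half, `1 / 2 * G (2 • (v n - w))`, has integral bounded by the norm once that is below
  -- `1`.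
  set g : Ω → ℝ := fun t => 1 + 1 / 2 * G ((2 : ℝ) • w t) + G (w t) with hg
  have hgi : Integrable g μ :=
    ((integrable_const 1).add ((w.integrable_smul 2).const_mul _)).add w.integrable_comp
  have hg0 : ∀ t, 0 ≤ g t := fun t => by
    have := G.nonneg' ((2 : ℝ) • w t)
    have := G.nonneg' (w t)
    positivity
  have hρg : ∀ n, Integrable (fun t => ρ n t * g t) μ := fun n =>
    hgi.mono' ((hm n).mul hgi.aestronglyMeasurable) (Eventually.of_forall fun t => by
      rw [Real.norm_of_nonneg (mul_nonneg (h0 n t) (hg0 t))]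
      exact mul_le_of_le_one_left (hg0 t) (h1 n t))
  have lim1 : Tendsto (fun n => ∫ t, ρ n t * g t ∂μ) atTop (𝓝 0) := by
    have := tendsto_integral_of_dominated_convergence (F := fun n t => ρ n t * g t)
      (f := fun _ => (0 : ℝ)) g (fun n => (hρg n).aestronglyMeasurable) hgi
      (fun n => Eventually.of_forall fun t => by
        rw [Real.norm_of_nonneg (mul_nonneg (h0 n t) (hg0 t))]
        exact mul_le_of_le_one_left (hg0 t) (h1 n t))
      (by
        filter_upwards [hρ] with t ht
        simpa using ht.mul_const (g t))
    simpa using this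
  have lim2 : Tendsto (fun n => ‖(2 : ℝ) • (v n - w)‖) atTop (𝓝 0) := by
    have h2 : Tendsto (fun n => (2 : ℝ) • (v n - w)) atTop (𝓝 ((2 : ℝ) • (w - w))) :=
      (h.sub_const w).const_smul 2
    simpa using h2.norm
  have lim : Tendsto (fun n => ∫ t, ρ n t * g t ∂μ + 1 / 2 * ‖(2 : ℝ) • (v n - w)‖)
      atTop (𝓝 0) := by
    simpa only [mul_zero, add_zero] using lim1.add (lim2.const_mul (1 / 2))
  refine squeeze_zero' (Eventually.of_forall fun n => integral_nonneg fun t => ?_) ?_ lim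
  · have := G.nonneg' (v n t)
    have := G.nonneg' (w t)
    have := h0 n t
    positivity
  filter_upwards [lim2.eventually_lt_const one_pos] with n hn
  have hd : Integrable (fun t => 1 / 2 * G (((2 : ℝ) • (v n - w)) t)) μ :=
    ((2 : ℝ) • (v n - w)).integrable_comp.const_mul _
  calc ∫ t, ρ n t * (1 + G (v n t) + G (w t)) ∂μ
      ≤ ∫ t, (ρ n t * g t + 1 / 2 * G (((2 : ℝ) • (v n - w)) t)) ∂μ := by
        refine integral_mono_of_nonneg (Eventually.of_forall fun t => ?_) ((hρg n).add hd) ?_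
        · have := G.nonneg' (v n t)
          have := G.nonneg' (w t)
          have := h0 n t
          simp only [Pi.zero_apply]
          positivity
        filter_upwards [coeFn_smul 2 (v n - w), coeFn_sub (v n) w] with t h3 h4
        rw [h3, h4]
        have h5 := G.midpoint_le (w t) (v n t - w t)
        rw [add_sub_cancel] at h5
        have h6 := G.nonneg' ((2 : ℝ) • (v n t - w t))
        have h7 : ρ n t * (1 + G (v n t) + G (w t)) ≤
            ρ n t * (g t + 1 / 2 * G ((2 : ℝ) • (v n t - w t))) :=
          mul_le_mul_of_nonneg_left (by simp only [hg]; linarith) (h0 n t)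
        have h8 := mul_le_mul_of_nonneg_right (h1 n t) h6
        linarith
    _ = ∫ t, ρ n t * g t ∂μ + 1 / 2 * ∫ t, G (((2 : ℝ) • (v n - w)) t) ∂μ := by
        rw [integral_add (hρg n) hd, integral_const_mul]
    _ ≤ _ := by
        gcongr
        exact integral_comp_le_norm hn

theorem tendsto_modularDeriv_of_ae (hG : ContDiff ℝ 1 G) {v : ℕ → OrliczSpace G μ}
    {w : OrliczSpace G μ} (h : Tendsto v atTop (𝓝 w))
    (hae : ∀ᵐ t ∂μ, Tendsto (fun n => v n t) atTop (𝓝 (w t))) :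
    Tendsto (fun n => modularDeriv hG (v n)) atTop (𝓝 (modularDeriv hG w)) := by
  have hc := hG.continuous_fderiv one_ne_zero
  rw [tendsto_iff_norm_sub_tendsto_zero, Metric.tendsto_atTop']
  intro ε hε
  set m := ∫ _, (1 : ℝ) ∂μ with hm
  have hm0 : 0 ≤ m := integral_nonneg fun _ => zero_le_one
  -- With `m` the total mass and `∫ G(φ) ≤ 1`, the term in `φ` contributes at most `η * (m + 1) = ε
  -- / 4`; the other term is eventually below `ε / 2`.
  set η := ε / (4 * (m + 1)) with hη
  have hη0 : 0 < η := by positivity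
  obtain ⟨C, hC, D, hD, hCD⟩ :=
    G.exists_fderiv_sub_apply_le (hG.differentiable one_ne_zero) hη0
  set ρ : ℕ → Ω → ℝ := fun n t => min 1 (D * ‖fderiv ℝ G (v n t) - fderiv ℝ G (w t)‖) with hρ
  have hρ0 : ∀ n t, 0 ≤ ρ n t := fun n t => by simp only [hρ]; positivity
  have hρ1 : ∀ n t, ρ n t ≤ 1 := fun n t => min_le_left _ _
  have hρm : ∀ n, AEStronglyMeasurable (ρ n) μ := fun n => by
    have h1 := hc.comp_aestronglyMeasurable (v n).aestronglyMeasurable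
    have h2 := hc.comp_aestronglyMeasurable w.aestronglyMeasurable
    exact aestronglyMeasurable_const.inf ((h1.sub h2).norm.const_mul D)
  have hρlim : ∀ᵐ t ∂μ, Tendsto (fun n => ρ n t) atTop (𝓝 0) := by
    filter_upwards [hae] with t ht
    have hcont : Continuous fun x => min 1 (D * ‖fderiv ℝ G x - fderiv ℝ G (w t)‖) := by
      fun_prop
    have h1 := hcont.tendsto (w t)
    rw [sub_self, norm_zero, mul_zero, min_eq_right zero_le_one] at h1
    exact h1.comp ht
  have lim := (tendsto_integral_mul_comp h hρm hρ0 hρ1 hρlim).const_mul C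
  rw [mul_zero] at lim
  obtain ⟨n₀, hn₀⟩ := eventually_atTop.1 (lim.eventually_lt_const (half_pos hε))
  refine ⟨n₀, fun n hn => ?_⟩
  have hI0 : 0 ≤ C * ∫ t, ρ n t * (1 + G (v n t) + G (w t)) ∂μ :=
    mul_nonneg hC (integral_nonneg fun t => mul_nonneg (hρ0 n t) (by
      have := G.nonneg' (v n t)
      have := G.nonneg' (w t)
      positivity))
  have hηm : η * (m + 1) = ε / 4 := by rw [hη]; field_simp
  have hbi : Integrable (fun t => 1 + G (v n t) + G (w t)) μ :=
    ((integrable_const 1).add (v n).integrable_comp).add w.integrable_comp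
  have hi : Integrable (fun t => C * (ρ n t * (1 + G (v n t) + G (w t)))) μ :=
    (hbi.bdd_mul (hρm n) (c := 1) (Eventually.of_forall fun t => by
      rw [Real.norm_of_nonneg (hρ0 n t)]; exact hρ1 n t)).const_mul C
  have key : ‖modularDeriv hG (v n) - modularDeriv hG w‖ ≤
      η * (m + 1) + C * ∫ t, ρ n t * (1 + G (v n t) + G (w t)) ∂μ := by
    refine ContinuousLinearMap.opNorm_le_bound _ (by positivity) ?_
    refine norm_apply_le_of_modular_le
      (modularDeriv hG (v n) - modularDeriv hG w).toLinearMap (by positivity) fun φ hφ => ?_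
    have hφi : Integrable (fun t => η * (1 + G (φ t))) μ :=
      ((integrable_const (1 : ℝ)).add φ.integrable_comp).const_mul η
    calc (modularDeriv hG (v n) - modularDeriv hG w) φ
        = ∫ t, (fderiv ℝ G (v n t) - fderiv ℝ G (w t)) (φ t) ∂μ := by
          rw [sub_apply, modularDeriv_apply, modularDeriv_apply,
            ← integral_sub (integrable_fderiv_apply hG _ _) (integrable_fderiv_apply hG _ _)]
          rfl
      _ ≤ ∫ t, (η * (1 + G (φ t)) + C * (ρ n t * (1 + G (v n t) + G (w t)))) ∂μ :=
          integral_mono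
            ((integrable_fderiv_apply hG (v n) φ).sub (integrable_fderiv_apply hG w φ))
            (hφi.add hi) fun t => hCD (v n t) (w t) (φ t)
      _ = η * (m + ∫ t, G (φ t) ∂μ) + C * ∫ t, ρ n t * (1 + G (v n t) + G (w t)) ∂μ := by
          rw [integral_add hφi hi, integral_const_mul, integral_const_mul,
            integral_add (integrable_const 1) φ.integrable_comp]
      _ ≤ _ := by gcongr
  have := hn₀ n hn.le
  rw [dist_zero_right, norm_norm]
  linarith

/-- Sequences suffice in a metric space, and it is enough that every subsequence has a further one
along which the derivatives converge; that one is chosen to converge a.e. -/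
theorem continuous_modularDeriv (hG : ContDiff ℝ 1 G) :
    Continuous (modularDeriv hG : OrliczSpace G μ → OrliczSpace G μ →L[ℝ] ℝ) := by
  refine continuous_iff_continuousAt.2 fun w => tendsto_of_seq_tendsto fun v hv =>
    tendsto_of_subseq_tendsto fun ns hns => ?_
  obtain ⟨ms, hms, hae⟩ := exists_subseq_tendsto_ae (hv.comp hns)
  exact ⟨ms, tendsto_modularDeriv_of_ae hG ((hv.comp hns).comp hms.tendsto_atTop) hae⟩

/-! ### Fréchet differentiability from convexity. -/

theorem hasFDerivAt_modular (hG : ContDiff ℝ 1 G) (v : OrliczSpace G μ) :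
    HasFDerivAt (fun u : OrliczSpace G μ => ∫ t, G (u t) ∂μ) (modularDeriv hG v) v := by
  have hd := hG.differentiable one_ne_zero
  have lower : ∀ u φ : OrliczSpace G μ,
      modularDeriv hG u φ ≤ ∫ t, G ((u + φ) t) ∂μ - ∫ t, G (u t) ∂μ := by
    intro u φ
    rw [modularDeriv_apply, ← integral_sub (u + φ).integrable_comp u.integrable_comp]
    refine integral_mono_ae (integrable_fderiv_apply hG u φ)
      ((u + φ).integrable_comp.sub u.integrable_comp) ?_
    filter_upwards [coeFn_add u φ] with t ht
    rw [ht]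
    exact G.fderiv_apply_le_sub hd _ _
  rw [hasFDerivAt_iff_isLittleO_nhds_zero, Asymptotics.isLittleO_iff]
  intro ε hε
  have h1 : Tendsto (fun φ => ‖modularDeriv hG (v + φ) - modularDeriv hG v‖) (𝓝 0) (𝓝 0) := by
    have h2 : Continuous fun φ => ‖modularDeriv hG (v + φ) - modularDeriv hG v‖ :=
      (((continuous_modularDeriv hG).comp (continuous_const.add continuous_id)).sub
        continuous_const).norm
    simpa using h2.tendsto 0
  filter_upwards [h1.eventually_lt_const hε] with φ hφ
  have h2 := lower v φ
  -- The subgradient inequality at `v + φ`, stepping back to `v`, is the upper bound of the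
  -- sandwich; `h2` is the lower one and makes the remainder nonnegative.
  have h3 := lower (v + φ) (-φ)
  rw [add_neg_cancel_right, map_neg] at h3
  have h4 := (le_abs_self _).trans ((modularDeriv hG (v + φ) - modularDeriv hG v).le_opNorm φ)
  rw [sub_apply] at h4
  have h5 := mul_le_mul_of_nonneg_right hφ.le (norm_nonneg φ)
  rw [Real.norm_of_nonneg (by linarith)]
  linarith

end OrliczSpace

/-! ### Transfer to the Orlicz-Sobolev space. -/

namespace W1LG

variable {N : ℕ} {G : GFunction N} {a b : ℝ}

/-- The weak derivative as a continuous linear map `W^1 L^G → L^G`. -/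
noncomputable def dotCLM : W1LG G a b →L[ℝ] LG G a b :=
  LinearMap.mkContinuous
    { toFun := dot
      map_add' := dot_add
      map_smul' := dot_smul } 1 fun u => by
    rw [one_mul]
    exact le_add_of_nonneg_left (norm_nonneg u.toLG)

theorem hasFDerivAt_modular_dot (hG : ContDiff ℝ 1 G) (u : W1LG G a b) :
    HasFDerivAt (lagrangianFunctional (fun _ _ v => G v) : W1LG G a b → ℝ)
      ((OrliczSpace.modularDeriv hG u.dot).comp dotCLM) u :=
  (OrliczSpace.hasFDerivAt_modular hG u.dot).comp u dotCLM.hasFDerivAt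

end W1LG

theorem mainTheorem2 {N : ℕ} (G : GFunction N) (hG : ContDiff ℝ 1 G) {a b : ℝ} (hab : a < b) :
    (∀ u : W1LG G a b, IntegrableOn (fun t => G (u.dot t)) (Ioo a b)) ∧
    ContDiff ℝ 1 (lagrangianFunctional (fun _ _ v => G v) : W1LG G a b → ℝ) ∧
    ∀ u φ : W1LG G a b,
      IntegrableOn (fun t => inner ℝ (gradient G (u.dot t)) (φ.dot t)) (Ioo a b) ∧
      fderiv ℝ (lagrangianFunctional (fun _ _ v => G v) : W1LG G a b → ℝ) u φ =
        ∫ t in Ioo a b, inner ℝ (gradient G (u.dot t)) (φ.dot t) := by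
  refine ⟨fun u => u.dot.integrable_comp, ?_, fun u φ => ?_⟩
  · refine contDiff_one_iff_hasFDerivAt.2 ⟨_, ?_, W1LG.hasFDerivAt_modular_dot hG⟩
    exact ((OrliczSpace.continuous_modularDeriv hG).comp W1LG.dotCLM.continuous).clm_comp
      continuous_const
  -- By the Riesz identification, pairing with the gradient is applying `fderiv`.
  · simp only [inner_gradient_left]
    refine ⟨OrliczSpace.integrable_fderiv_apply hG u.dot φ.dot, ?_⟩
    rw [(W1LG.hasFDerivAt_modular_dot hG u).fderiv]
    rfl
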